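/- **Setting.** Let $\Omega\subset\mathbb R^3$ be a bounded open set on which the divergence theorem can be used. That is: $\partial\Omega$ has finite area (two-dimensional Hausdorff measure $S$), it has an outward unit normal $\nu$ at $S$-almost every point, $\nu$ is $S$-measurable, and $\int_\Omega\partial_j\varphi\,dx=\int_{\partial\Omega}\varphi\,\nu_j\,dS$ for all $\varphi\in C_c^\infty(\mathbb R^3)$ and $j=1,2,3$. Here $n$, $|n|=1$, is the outward unit normal at $x$ if for every $\varepsilon>0$ all $y$ close enough to $x$ satisfy $(y-x)\cdot n\le\varepsilon|y-x|$ when $y\in\Omega$ and $(y-x)\cdot n\ge-\varepsilon|y-x|$ when $y\notin\Omega$. (Every bounded Lipschitz domain qualifies.) Let $T>0$. Let $u(t,x)\in\mathbb R^3$ be continuous with continuous spatial derivatives on a neighbourhood of $[0,T]\times\overline\Omega$. Let $B^0:\Omega\to\mathbb R^3$ be initial data, and let $B^b$ be boundary data with $B^b(t)\in L^2(\partial\Omega)$ for every $t\in(0,T)$. Let $B(t,x)\in\mathbb R^3$ be $C^1$ in $(t,x)$ on a neighbourhood of $[0,T]\times\overline\Omega$ and solve, with summation over $j$ and for $i=1,2,3$,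 $$\partial_tB_i=B_j\partial_ju_i-\tfrac12B_i\partial_ju_j-\tfrac12u_j\partial_jB_i-\tfrac12\partial_j(u_jB_i)\quad\text{in }(0,T)\times\Omega,$$ $$B(t,x)=B^b(t,x)\ \text{ for } t\in(0,T),\ x\in\partial\Omega \text{ with } u(t,x)\cdot\nu(x)<0,\qquad B(0,x)=B^0(x)\ \text{ for } x\in\Omega.$$ Write $\|\nabla u(t)\|_{L^\infty(\Omega)}=\max_{i,j}\|\partial_ju_i(t)\|_{L^\infty(\Omega)}$ and $\|\nabla u\|_\infty=\max_{i,j}\|\partial_ju_i\|_{L^\infty((0,T)\times\Omega)}$, and let $\|u(t)\|_{L^\infty(\partial\Omega)}$ be the essential supremum of the Euclidean length $|u(t,\cdot)|$ on $\partial\Omega$. **Claim.** For every $t\in(0,T)$, the function $t\mapsto\|B(t)\|_{L^2(\Omega)}^2$ is differentiable at $t$ and $$\frac{d}{dt}\|B(t)\|_{L^2(\Omega)}^2=2\int_\Omega B\cdot\partial_tB\,dx\le 9\,\|\nabla u(t)\|_{L^\infty(\Omega)}\|B(t)\|_{L^2(\Omega)}^2+\|u(t)\|_{L^\infty(\partial\Omega)}\|B^b(t)\|_{L^2(\partial\Omega)}^2.$$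 Moreover, if $t\mapsto\|u(t)\|_{L^\infty(\partial\Omega)}\|B^b(t)\|_{L^2(\partial\Omega)}^2$ is integrable on $(0,T)$, then for every $t\in[0,T]$ $$\|B(t)\|_{L^2(\Omega)}^2\le \exp\bigl(9\|\nabla u\|_\infty t\bigr)\Bigl(\|B^0\|_{L^2(\Omega)}^2+\int_0^t\|u(s)\|_{L^\infty(\partial\Omega)}\|B^b(s)\|_{L^2(\partial\Omega)}^2\,ds\Bigr).$$ -/

import Mathlib

open MeasureTheory Set Filter Topology
open scoped ContDiff

noncomputable section

/-- Euclidean three-space. -/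
abbrev E3 : Type := EuclideanSpace ℝ (Fin 3)

/-- The partial derivative `∂ⱼ f` of a scalar function on `ℝ³`. -/
def pd (j : Fin 3) (f : E3 → ℝ) (x : E3) : ℝ :=
  fderiv ℝ f x (EuclideanSpace.single j 1)

/-- `n` is the outward unit normal of `Ω` at `x`: to first order at `x`, the set `Ω` coincides with
the half space `{y | ⟪y - x, n⟫ < 0}`. -/
def IsOutwardNormal (Ω : Set E3) (x n : E3) : Prop :=
  ‖n‖ = 1 ∧ ∀ ε : ℝ, 0 < ε → ∀ᶠ y in 𝓝 x,
    (y ∈ Ω → inner ℝ (y - x) n ≤ ε * ‖y - x‖) ∧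
    (y ∉ Ω → -(ε * ‖y - x‖) ≤ inner ℝ (y - x) n)

/-- The outward unit normal is unique where it exists. -/
theorem IsOutwardNormal.unique {Ω : Set E3} {x m n : E3}
    (hm : IsOutwardNormal Ω x m) (hn : IsOutwardNormal Ω x n) : m = n := by
  by_contra hne
  set v : E3 := m - n with hv
  have hv0 : 0 < ‖v‖ := norm_pos_iff.2 (sub_ne_zero.2 hne)
  have hmm : inner ℝ m m = (1 : ℝ) := by rw [real_inner_self_eq_norm_sq, hm.1]; norm_num
  have hnn : inner ℝ n n = (1 : ℝ) := by rw [real_inner_self_eq_norm_sq, hn.1]; norm_num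
  have hvv : inner ℝ v v = ‖v‖ ^ 2 := real_inner_self_eq_norm_sq v
  have hnm : inner ℝ n m = (inner ℝ m n : ℝ) := real_inner_comm m n
  have hvm : inner ℝ v m = ‖v‖ ^ 2 / 2 := by
    rw [← hvv]; simp only [hv, inner_sub_left, inner_sub_right]; linarith
  have hvn : inner ℝ v n = -(‖v‖ ^ 2 / 2) := by
    rw [← hvv]; simp only [hv, inner_sub_left, inner_sub_right]; linarith
  have hε : 0 < ‖v‖ / 4 := by positivity
  have hlim : Tendsto (fun t : ℝ => x + t • v) (𝓝[>] 0) (𝓝 x) := by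
    have : Tendsto (fun t : ℝ => x + t • v) (𝓝 0) (𝓝 (x + (0 : ℝ) • v)) :=
      Continuous.tendsto (by fun_prop) 0
    rw [zero_smul, add_zero] at this
    exact this.mono_left nhdsWithin_le_nhds
  obtain ⟨t, ⟨h1, h2⟩, ht⟩ :=
    (((hlim.eventually (hm.2 _ hε)).and (hlim.eventually (hn.2 _ hε))).and
      self_mem_nhdsWithin).exists
  have ht0 : (0 : ℝ) < t := ht
  have hpos : 0 < t * ‖v‖ ^ 2 := by positivity
  simp only [add_sub_cancel_left, inner_smul_left, norm_smul, Real.norm_eq_abs, abs_of_pos ht0,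
    hvm, hvn, RCLike.conj_to_real] at h1 h2
  by_cases hy : x + t • v ∈ Ω
  · have := h1.1 hy
    nlinarith
  · have := h2.2 hy
    nlinarith

open Classical in
/-- The outward unit normal field `ν` of `Ω`, set to `0` where there is no normal. -/
def outwardNormal (Ω : Set E3) (x : E3) : E3 :=
  if h : ∃ n, IsOutwardNormal Ω x n then h.choose else 0

/-- The surface measure of `∂Ω`: two-dimensional Hausdorff measure on the topological boundary,
normalised so that it is the usual area on planes. -/
def surfaceMeasure (Ω : Set E3) : Measure E3 :=
  (Measure.euclideanHausdorffMeasure 2 : Measure E3).restrict (frontier Ω)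

/-- Volumes in which one can integrate by parts: bounded open sets whose boundary has finite area
and an outward unit normal `ν` at almost every point, and whose indicator function has the
distributional gradient `-ν dS`. Bounded Lipschitz domains are of this kind. -/
structure IsGaussDomain (Ω : Set E3) : Prop where
  isOpen : IsOpen Ω
  isBounded : Bornology.IsBounded Ω
  finite_area : surfaceMeasure Ω univ < ⊤
  ae_normal : ∀ᵐ x ∂(surfaceMeasure Ω), IsOutwardNormal Ω x (outwardNormal Ω x)
  measurable_normal : AEStronglyMeasurable (outwardNormal Ω) (surfaceMeasure Ω)
  gauss_green : ∀ φ : E3 → ℝ, ContDiff ℝ ∞ φ → HasCompactSupport φ → ∀ j : Fin 3,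
    ∫ x in Ω, pd j φ x = ∫ x, φ x * outwardNormal Ω x j ∂(surfaceMeasure Ω)

/-- `‖f‖²` in `L²(μ)` for a vector field `f`. -/
def normSqL2 (f : E3 → E3) (μ : Measure E3) : ℝ := (eLpNorm f 2 μ).toReal ^ 2

/-- `‖u‖_{L^∞(∂Ω)}`, with the Euclidean length of `u`. -/
def supNormBoundary (Ω : Set E3) (v : E3 → E3) : ℝ :=
  (eLpNorm v ⊤ (surfaceMeasure Ω)).toReal

/-- `‖∇v‖_{L^∞(Ω)} = max_{i,j} ‖∂ⱼ vᵢ‖_{L^∞(Ω)}`. -/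
def gradNorm (Ω : Set E3) (v : E3 → E3) : ℝ :=
  (⨆ i : Fin 3, ⨆ j : Fin 3,
    eLpNorm (fun x => pd j (fun y => v y i) x) ⊤ (volume.restrict Ω)).toReal

/-- `‖∇u‖_∞ = max_{i,j} ‖∂ⱼ uᵢ‖_{L^∞((0,T) × Ω)}`. -/
def gradNormSpaceTime (T : ℝ) (Ω : Set E3) (u : ℝ → E3 → E3) : ℝ :=
  (⨆ i : Fin 3, ⨆ j : Fin 3,
    eLpNorm (fun p : ℝ × E3 => pd j (fun y => u p.1 y i) p.2) ⊤
      (volume.restrict (Ioo 0 T ×ˢ Ω))).toReal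

/-- The velocity `u` is continuous with continuous spatial derivative up to the boundary, that is,
on a neighbourhood of `[0,T] × closure Ω`. -/
def IsSmoothVelocity (T : ℝ) (Ω : Set E3) (u : ℝ → E3 → E3) : Prop :=
  ∃ U : Set (ℝ × E3), IsOpen U ∧ Icc 0 T ×ˢ closure Ω ⊆ U ∧
    ContinuousOn (fun p : ℝ × E3 => u p.1 p.2) U ∧
    (∀ p ∈ U, DifferentiableAt ℝ (u p.1) p.2) ∧
    ContinuousOn (fun p : ℝ × E3 => fderiv ℝ (u p.1) p.2) U

/-- `B` is continuously differentiable in `(t,x)` up to the boundary, that is, on a neighbourhood of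
`[0,T] × closure Ω`. -/
def IsSmoothField (T : ℝ) (Ω : Set E3) (B : ℝ → E3 → E3) : Prop :=
  ∃ U : Set (ℝ × E3), IsOpen U ∧ Icc 0 T ×ˢ closure Ω ⊆ U ∧
    ContDiffOn ℝ 1 (fun p : ℝ × E3 => B p.1 p.2) U

/-- The time derivative `∂ₜ B`. -/
def timeDeriv (B : ℝ → E3 → E3) (t : ℝ) (x : E3) : E3 := deriv (fun s => B s x) t

/-- The `i`-th component of the right-hand side of the induction equation in split form,
`Bⱼ ∂ⱼuᵢ - ½ Bᵢ ∂ⱼuⱼ - ½ uⱼ ∂ⱼBᵢ - ½ ∂ⱼ(uⱼ Bᵢ)`, summed over `j`. -/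
def splitTransport (v b : E3 → E3) (i : Fin 3) (x : E3) : ℝ :=
  ∑ j : Fin 3,
    (b x j * pd j (fun y => v y i) x
      - (1 / 2) * (b x i * pd j (fun y => v y j) x)
      - (1 / 2) * (v x j * pd j (fun y => b y i) x)
      - (1 / 2) * pd j (fun y => v y j * b y i) x)

/-- `B` solves the initial boundary value problem for the linear induction equation in split form,
with initial data `B0` and with boundary data `Bb` imposed on the inflow part of `∂Ω`. -/
structure SolvesInduction (T : ℝ) (Ω : Set E3) (u : ℝ → E3 → E3)
    (B0 : E3 → E3) (Bb B : ℝ → E3 → E3) : Prop where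
  smooth : IsSmoothField T Ω B
  pde : ∀ t ∈ Ioo 0 T, ∀ x ∈ Ω, ∀ i : Fin 3,
    timeDeriv B t x i = splitTransport (u t) (B t) i x
  inflow : ∀ t ∈ Ioo 0 T, ∀ x ∈ frontier Ω,
    inner ℝ (u t x) (outwardNormal Ω x) < 0 → B t x = Bb t x
  initial : ∀ x ∈ Ω, B 0 x = B0 x

end

/-! Multiply the equation by `2B`. The split form is arranged so that every derivative of `B` is
absorbed into the exact divergence of `u|B|²`; what remains is quadratic in `B` with coefficients
`∂ⱼuᵢ` (`two_mul_sum_mul_splitTransport`). Gauss–Green turns the divergence into the boundary flux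
`-∫ (u·ν)|B|²`. Where `u·ν ≥ 0` this has a favourable sign; where `u·ν < 0` the boundary condition
replaces `B` by `Bb`. The quadratic remainder costs the factor 9 (`stretchingDensity_le`).

Since the flux is only C¹ near `closure Ω`, Gauss–Green is first extended from test functions by
mollification and cut-off (`gauss_green_of_contDiffOn`). Differentiating under the integral
identifies the tested equation with the derivative of the energy. Grönwall then gives the global
bound, once the gradient norm of each time slice is bounded by the space-time one (`gradNorm_le`).
-/

theorem norm_outwardNormal_le_one (Ω : Set E3) (x : E3) : ‖outwardNormal Ω x‖ ≤ 1 := by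
  unfold outwardNormal
  split_ifs with h
  · exact h.choose_spec.1.le
  -- Without a normal the field has the default value `0`, so the bound holds everywhere and not
  -- only almost everywhere.
  · simp

theorem abs_outwardNormal_apply_le_one (Ω : Set E3) (x : E3) (j : Fin 3) :
    |outwardNormal Ω x j| ≤ 1 :=
  (PiLp.norm_apply_le (outwardNormal Ω x) j).trans (norm_outwardNormal_le_one Ω x)

theorem IsGaussDomain.isFiniteMeasure {Ω : Set E3} (hΩ : IsGaussDomain Ω) :
    IsFiniteMeasure (surfaceMeasure Ω) := ⟨hΩ.finite_area⟩

theorem IsGaussDomain.isCompact_closure {Ω : Set E3} (hΩ : IsGaussDomain Ω) :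
    IsCompact (closure Ω) := hΩ.isBounded.isCompact_closure

theorem IsGaussDomain.isFiniteMeasure_restrict {Ω : Set E3} (hΩ : IsGaussDomain Ω) :
    IsFiniteMeasure (volume.restrict Ω) :=
  ⟨by rw [Measure.restrict_apply_univ]; exact hΩ.isBounded.measure_lt_top⟩

theorem IsGaussDomain.aestronglyMeasurable_normal_apply {Ω : Set E3} (hΩ : IsGaussDomain Ω)
    (j : Fin 3) : AEStronglyMeasurable (fun x => outwardNormal Ω x j) (surfaceMeasure Ω) :=
  (EuclideanSpace.proj (𝕜 := ℝ) j).continuous.comp_aestronglyMeasurable hΩ.measurable_normal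

theorem ae_surfaceMeasure_mem_frontier (Ω : Set E3) :
    ∀ᵐ x ∂(surfaceMeasure Ω), x ∈ frontier Ω :=
  ae_restrict_mem isClosed_frontier.measurableSet

/-! ### Gauss–Green for functions that are C¹ up to the boundary. -/

theorem exists_norm_le_of_hasCompactSupport {g : E3 → ℝ} (hg : Continuous g)
    (hc : HasCompactSupport g) : ∃ C, 0 ≤ C ∧ ∀ x, ‖g x‖ ≤ C := by
  obtain ⟨C, hC⟩ := hg.bounded_above_of_compact_support hc
  exact ⟨C, (norm_nonneg _).trans (hC 0), hC⟩

/-- A normalised bump is a probability density, so the convolution is an average of `g`. The bound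
does not depend on the bump and serves as the dominating constant for mollifications. -/
theorem ContDiffBump.norm_normed_convolution_le (φ : ContDiffBump (0 : E3)) {g : E3 → ℝ}
    (hg : Continuous g) {C : ℝ} (hC : 0 ≤ C) (hgC : ∀ x, ‖g x‖ ≤ C) (x : E3) :
    ‖convolution (φ.normed volume) g (ContinuousLinearMap.lsmul ℝ ℝ) volume x‖ ≤ C := by
  have := dist_convolution_le' (μ := volume) (ContinuousLinearMap.lsmul ℝ ℝ) (x₀ := x) (z₀ := (0 : ℝ)) hC
    φ.integrable_normed φ.support_normed_eq.subset hg.aestronglyMeasurable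
    (fun y _ => by simpa using hgC y)
  simp only [map_zero, integral_zero, dist_zero_right] at this
  refine this.trans ?_
  simp_rw [Real.norm_of_nonneg (φ.nonneg_normed _), φ.integral_normed, mul_one]
  exact (mul_le_mul_of_nonneg_right ContinuousLinearMap.opNorm_lsmul_le hC).trans_eq (one_mul C)

/-- The Gauss–Green formula extends from smooth to continuously differentiable functions. -/
theorem IsGaussDomain.gauss_green_of_contDiff_one {Ω : Set E3} (hΩ : IsGaussDomain Ω)
    {g : E3 → ℝ} (hg : ContDiff ℝ 1 g) (hc : HasCompactSupport g) (j : Fin 3) :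
    ∫ x in Ω, pd j g x = ∫ x, g x * outwardNormal Ω x j ∂(surfaceMeasure Ω) := by
  have := hΩ.isFiniteMeasure
  have := hΩ.isFiniteMeasure_restrict
  let φ : ℕ → ContDiffBump (0 : E3) := fun n =>
    ⟨1 / (n + 1) / 2, 1 / (n + 1), by positivity, half_lt_self (by positivity)⟩
  have hφ : Tendsto (fun n => (φ n).rOut) atTop (𝓝 0) := tendsto_one_div_add_atTop_nhds_zero_nat
  let G : ℕ → E3 → ℝ := fun n =>
    convolution ((φ n).normed volume) g (ContinuousLinearMap.lsmul ℝ ℝ) volume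
  have hpdc : Continuous (pd j g) := (hg.continuous_fderiv one_ne_zero).clm_apply continuous_const
  have hpds : HasCompactSupport (pd j g) :=
    (hc.fderiv ℝ).comp_left (g := fun L : E3 →L[ℝ] ℝ => L (EuclideanSpace.single j 1)) rfl
  have hloc : ∀ n, LocallyIntegrable ((φ n).normed volume : E3 → ℝ) volume :=
    fun n => (φ n).integrable_normed.locallyIntegrable
  -- The derivative is moved onto `g`, so `∂ⱼ(G n)` is itself a mollification of the continuous
  -- function `∂ⱼg` and converges boundedly.
  have hpdG : ∀ n x, pd j (G n) x = convolution ((φ n).normed volume) (pd j g)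
      (ContinuousLinearMap.lsmul ℝ ℝ) volume x := by
    intro n x
    have := (hc.hasFDerivAt_convolution_right (ContinuousLinearMap.lsmul ℝ ℝ) (hloc n) hg x).fderiv
    simp only [pd, G]
    rw [this, convolution_precompR_apply _ (hloc n) (hc.fderiv ℝ)
      (hg.continuous_fderiv one_ne_zero)]
    rfl
  have hGsmooth : ∀ n, ContDiff ℝ ∞ (G n) := fun n =>
    (φ n).hasCompactSupport_normed.contDiff_convolution_left _ (φ n).contDiff_normed
      hg.continuous.locallyIntegrable
  have hGsupp : ∀ n, HasCompactSupport (G n) := fun n =>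
    (φ n).hasCompactSupport_normed.convolution _ hc
  have heq := fun n => hΩ.gauss_green (G n) (hGsmooth n) (hGsupp n) j
  obtain ⟨C, hC0, hC⟩ := exists_norm_le_of_hasCompactSupport hg.continuous hc
  obtain ⟨D, hD0, hD⟩ := exists_norm_le_of_hasCompactSupport hpdc hpds
  have h1 : Tendsto (fun n => ∫ x in Ω, pd j (G n) x) atTop (𝓝 (∫ x in Ω, pd j g x)) := by
    refine tendsto_integral_of_dominated_convergence (fun _ => D) (fun n => ?_)
      (integrable_const D) (fun n => ae_of_all _ fun x => ?_) (ae_of_all _ fun x => ?_)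
    · exact (((hGsmooth n).continuous_fderiv (by simp)).clm_apply
        continuous_const).aestronglyMeasurable
    · rw [hpdG]
      exact (φ n).norm_normed_convolution_le hpdc hD0 hD x
    · simp_rw [hpdG]
      exact ContDiffBump.convolution_tendsto_right_of_continuous hφ hpdc x
  have h2 : Tendsto (fun n => ∫ x, G n x * outwardNormal Ω x j ∂(surfaceMeasure Ω)) atTop
      (𝓝 (∫ x, g x * outwardNormal Ω x j ∂(surfaceMeasure Ω))) := by
    refine tendsto_integral_of_dominated_convergence (fun _ => C) (fun n => ?_)
      (integrable_const C) (fun n => ae_of_all _ fun x => ?_) (ae_of_all _ fun x => ?_)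
    · exact (hGsmooth n).continuous.aestronglyMeasurable.mul
        (hΩ.aestronglyMeasurable_normal_apply j)
    · rw [norm_mul]
      exact (mul_le_of_le_one_right (norm_nonneg _) (abs_outwardNormal_apply_le_one Ω x j)).trans
        ((φ n).norm_normed_convolution_le hg.continuous hC0 hC x)
    · exact (ContDiffBump.convolution_tendsto_right_of_continuous hφ hg.continuous x).mul_const _
  exact tendsto_nhds_unique h1 (h2.congr fun n => (heq n).symm)

/-- Multiply by a cut-off that is 1 near `K` and vanishes off a compact subset of `W`. Agreement of
germs, rather than of values on `K`, makes the derivatives agree too. -/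
theorem IsCompact.exists_contDiff_one_eq_near {K W : Set E3} (hK : IsCompact K) (hW : IsOpen W)
    (hKW : K ⊆ W) {f : E3 → ℝ} (hf : ContDiffOn ℝ 1 f W) :
    ∃ g : E3 → ℝ, ContDiff ℝ 1 g ∧ HasCompactSupport g ∧ ∀ x ∈ K, g =ᶠ[𝓝 x] f := by
  obtain ⟨L, hL, hKL, hLW⟩ := exists_compact_between hK hW hKW
  obtain ⟨χ, hχ1, hχ0, -⟩ := exists_contMDiffMap_one_nhds_of_subset_interior
    (n := 1) (modelWithCornersSelf ℝ E3) hK.isClosed hKL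
  have hχ : ContDiff ℝ 1 χ := χ.contMDiff.contDiff
  refine ⟨fun x => χ x * f x, ?_, ?_, fun x hx => ?_⟩
  · rw [contDiff_iff_contDiffAt]
    intro x
    by_cases hx : x ∈ W
    · exact hχ.contDiffAt.mul (hf.contDiffAt (hW.mem_nhds hx))
    -- Nothing is known about `f` here, but the product vanishes near `x`, as the complement of `L`
    -- is open.
    · have : (fun y => χ y * f y) =ᶠ[𝓝 x] fun _ => (0 : ℝ) := by
        filter_upwards [hL.isClosed.isOpen_compl.mem_nhds fun h => hx (hLW h)] with y hy
        rw [hχ0 y hy, zero_mul]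
      exact contDiffAt_const.congr_of_eventuallyEq this
  · exact HasCompactSupport.intro hL fun x hx => by rw [hχ0 x hx, zero_mul]
  · filter_upwards [hχ1.filter_mono (nhds_le_nhdsSet hx)] with y hy
    rw [hy, one_mul]

/-- The Gauss–Green formula for functions that are continuously differentiable up to the
boundary. -/
theorem IsGaussDomain.gauss_green_of_contDiffOn {Ω W : Set E3} (hΩ : IsGaussDomain Ω)
    (hW : IsOpen W) (hΩW : closure Ω ⊆ W) {f : E3 → ℝ} (hf : ContDiffOn ℝ 1 f W) (j : Fin 3) :
    ∫ x in Ω, pd j f x = ∫ x, f x * outwardNormal Ω x j ∂(surfaceMeasure Ω) := by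
  obtain ⟨g, hg, hc, hgf⟩ := hΩ.isCompact_closure.exists_contDiff_one_eq_near hW hΩW hf
  have := hΩ.gauss_green_of_contDiff_one hg hc j
  rw [setIntegral_congr_fun (g := pd j f) hΩ.isOpen.measurableSet fun x hx => by
    simp only [pd, (hgf x (subset_closure hx)).fderiv_eq]] at this
  rw [this]
  refine integral_congr_ae ?_
  filter_upwards [ae_surfaceMeasure_mem_frontier Ω] with x hx
  rw [(hgf x (frontier_subset_closure hx)).self_of_nhds]

/-! ### Norms as integrals and pointwise bounds; calculus of `pd`. -/

theorem normSqL2_eq_integral {f : E3 → E3} {μ : Measure E3} (hf : MemLp f 2 μ) :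
    normSqL2 f μ = ∫ x, ‖f x‖ ^ 2 ∂μ := by
  have h0 : 0 ≤ ∫ x, ‖f x‖ ^ 2 ∂μ := integral_nonneg fun x => by positivity
  rw [normSqL2, hf.eLpNorm_eq_integral_rpow_norm two_ne_zero ENNReal.ofNat_ne_top]
  simp only [ENNReal.toReal_ofNat, Real.rpow_ofNat]
  rw [ENNReal.toReal_ofReal (by positivity), ← Real.rpow_natCast, ← Real.rpow_mul h0]
  norm_num

theorem normSqL2_nonneg (f : E3 → E3) (μ : Measure E3) : 0 ≤ normSqL2 f μ := sq_nonneg _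

theorem pd_mul {f g : E3 → ℝ} {x : E3} (hf : DifferentiableAt ℝ f x) (hg : DifferentiableAt ℝ g x)
    (j : Fin 3) : pd j (fun y => f y * g y) x = pd j f x * g x + f x * pd j g x := by
  have := (hf.hasFDerivAt.mul hg.hasFDerivAt).fderiv
  simp only [pd]
  erw [this]
  simp
  ring

theorem pd_sum_sq {b : E3 → E3} {x : E3} (hb : ∀ i, DifferentiableAt ℝ (fun y => b y i) x)
    (j : Fin 3) :
    pd j (fun y => ∑ i, b y i * b y i) x = ∑ i, 2 * (b x i * pd j (fun y => b y i) x) := by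
  have h : pd j (fun y => ∑ i, b y i * b y i) x = ∑ i, pd j (fun y => b y i * b y i) x := by
    simp only [pd]
    rw [fderiv_fun_sum (A := fun i y => b y i * b y i) fun i _ => (hb i).mul (hb i)]
    simp
  rw [h]
  refine Finset.sum_congr rfl fun i _ => ?_
  rw [pd_mul (hb i) (hb i)]
  ring

theorem continuousOn_pd {W : Set E3} (hW : IsOpen W) {f : E3 → ℝ} (hf : ContDiffOn ℝ 1 f W)
    (j : Fin 3) : ContinuousOn (pd j f) W :=
  (hf.continuousOn_fderiv_of_isOpen hW le_rfl).clm_apply continuousOn_const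

theorem ContDiffOn.e3_apply {W : Set E3} {v : E3 → E3} (hv : ContDiffOn ℝ 1 v W) (i : Fin 3) :
    ContDiffOn ℝ 1 (fun y => v y i) W :=
  (EuclideanSpace.proj (𝕜 := ℝ) i).contDiff.comp_contDiffOn hv

theorem IsGaussDomain.integrableOn {Ω : Set E3} (hΩ : IsGaussDomain Ω) {f : E3 → ℝ}
    (hf : ContinuousOn f (closure Ω)) : IntegrableOn f Ω :=
  (hf.integrableOn_compact hΩ.isCompact_closure).mono_set subset_closure

theorem IsGaussDomain.memLp {Ω : Set E3} (hΩ : IsGaussDomain Ω) {f : E3 → E3}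
    (hf : ContinuousOn f (closure Ω)) : MemLp f 2 (volume.restrict Ω) := by
  have := hΩ.isFiniteMeasure_restrict
  obtain ⟨C, hC⟩ := hΩ.isCompact_closure.exists_bound_of_continuousOn hf
  refine MemLp.of_bound ((hf.mono subset_closure).aestronglyMeasurable hΩ.isOpen.measurableSet)
    C ?_
  filter_upwards [ae_restrict_mem hΩ.isOpen.measurableSet] with x hx
  exact hC x (subset_closure hx)

theorem IsGaussDomain.ae_norm_le_supNormBoundary {Ω : Set E3} (hΩ : IsGaussDomain Ω) {v : E3 → E3}
    (hv : ContinuousOn v (closure Ω)) :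
    ∀ᵐ x ∂(surfaceMeasure Ω), ‖v x‖ ≤ supNormBoundary Ω v := by
  obtain ⟨C, hC⟩ := hΩ.isCompact_closure.exists_bound_of_continuousOn hv
  -- Finiteness is essential: `toReal` sends `⊤` to `0`, which would bound nothing.
  have hfin : eLpNormEssSup v (surfaceMeasure Ω) < ⊤ := by
    refine eLpNormEssSup_lt_top_of_ae_bound (C := C) ?_
    filter_upwards [ae_surfaceMeasure_mem_frontier Ω] with x hx
    exact hC x (frontier_subset_closure hx)
  filter_upwards [ae_le_eLpNormEssSup (f := v) (μ := surfaceMeasure Ω)] with x hx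
  rw [supNormBoundary, eLpNorm_exponent_top, ← toReal_enorm]
  exact ENNReal.toReal_mono hfin.ne hx

/-- An entry of a matrix of essentially bounded functions is bounded by the largest of the
essential suprema. -/
theorem ae_norm_le_iSup_eLpNorm {α : Type*} [MeasurableSpace α] {μ : Measure α}
    {f : Fin 3 → Fin 3 → α → ℝ} (hf : ∀ i j, ∃ C : ℝ, ∀ᵐ x ∂μ, ‖f i j x‖ ≤ C) (i j : Fin 3) :
    ∀ᵐ x ∂μ, ‖f i j x‖ ≤ (⨆ i, ⨆ j, eLpNorm (f i j) ⊤ μ).toReal := by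
  have hfin : (⨆ i, ⨆ j, eLpNorm (f i j) ⊤ μ) < ⊤ := by
    choose C hC using hf
    obtain ⟨K, hK⟩ := (Set.finite_range fun p : Fin 3 × Fin 3 => C p.1 p.2).bddAbove
    refine (iSup₂_le fun i j => ?_).trans_lt (ENNReal.ofReal_lt_top (r := K))
    rw [eLpNorm_exponent_top]
    exact (eLpNormEssSup_le_of_ae_bound (hC i j)).trans
      (ENNReal.ofReal_le_ofReal (hK ⟨(i, j), rfl⟩))
  filter_upwards [ae_le_eLpNormEssSup (f := f i j) (μ := μ)] with x hx
  rw [← toReal_enorm]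
  refine ENNReal.toReal_mono hfin.ne (hx.trans ?_)
  rw [← eLpNorm_exponent_top]
  exact le_iSup₂ (f := fun i j => eLpNorm (f i j) ⊤ μ) i j

theorem IsGaussDomain.ae_norm_pd_le_gradNorm {Ω W : Set E3} (hΩ : IsGaussDomain Ω)
    (hW : IsOpen W) (hΩW : closure Ω ⊆ W) {v : E3 → E3} (hv : ContDiffOn ℝ 1 v W) (i j : Fin 3) :
    ∀ᵐ x ∂(volume.restrict Ω), ‖pd j (fun y => v y i) x‖ ≤ gradNorm Ω v := by
  refine ae_norm_le_iSup_eLpNorm (f := fun i j x => pd j (fun y => v y i) x) (fun i j => ?_) i j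
  obtain ⟨C, hC⟩ := hΩ.isCompact_closure.exists_bound_of_continuousOn
    ((continuousOn_pd hW (hv.e3_apply i) j).mono hΩW)
  refine ⟨C, ?_⟩
  filter_upwards [ae_restrict_mem hΩ.isOpen.measurableSet] with x hx
  exact hC x (subset_closure hx)

/-! ### The energy estimate at a fixed time. -/

/-- The volume density left over when the transport terms are written as a divergence. -/
noncomputable def stretchingDensity (v b : E3 → E3) (x : E3) : ℝ :=
  ∑ i, ∑ j, (2 * (b x i * b x j) * pd j (fun y => v y i) x
    - b x i * b x i * pd j (fun y => v y j) x)

/-- By the product rule the two half transport terms, tested with `2bᵢ`, give `-2bᵢvⱼ∂ⱼbᵢ -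
bᵢ²∂ⱼvⱼ`, which is exactly `-∂ⱼ(vⱼbᵢ²)`. -/
theorem two_mul_sum_mul_splitTransport {v b : E3 → E3} {x : E3}
    (hv : ∀ i, DifferentiableAt ℝ (fun y => v y i) x)
    (hb : ∀ i, DifferentiableAt ℝ (fun y => b y i) x) :
    2 * ∑ i, b x i * splitTransport v b i x =
      stretchingDensity v b x - ∑ j, pd j (fun y => v y j * ∑ i, b y i * b y i) x := by
  have hs : DifferentiableAt ℝ (fun y => ∑ i, b y i * b y i) x :=
    DifferentiableAt.fun_sum fun i _ => (hb i).mul (hb i)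
  have hflux : ∀ j, pd j (fun y => v y j * ∑ i, b y i * b y i) x = pd j (fun y => v y j) x *
      ∑ i, b x i * b x i + v x j * ∑ i, 2 * (b x i * pd j (fun y => b y i) x) := fun j => by
    rw [pd_mul (hv j) hs, pd_sum_sq hb]
  simp only [hflux]
  simp only [stretchingDensity, splitTransport, pd_mul (hv _) (hb _), Fin.sum_univ_three]
  ring

/-- Young's inequality bounds the `(i,j)` term by `G(2bᵢ² + bⱼ²)`. Summing over nine pairs gives
`(2·3 + 3)G|b|²`, whence the 9. -/
theorem stretchingDensity_le {v b : E3 → E3} {x : E3} {G : ℝ}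
    (hG : ∀ i j, ‖pd j (fun y => v y i) x‖ ≤ G) :
    stretchingDensity v b x ≤ 9 * G * ‖b x‖ ^ 2 := by
  have h : ∀ i j, 2 * (b x i * b x j) * pd j (fun y => v y i) x
      - b x i * b x i * pd j (fun y => v y j) x ≤ G * (2 * b x i ^ 2 + b x j ^ 2) := by
    intro i j
    obtain ⟨h1, h2⟩ := abs_le.1 (hG i j)
    obtain ⟨h3, h4⟩ := abs_le.1 (hG j j)
    -- With `d = ∂ⱼvᵢ`, adding `(G-d)(bᵢ+bⱼ)² ≥ 0` and `(G+d)(bᵢ-bⱼ)² ≥ 0` gives `2bᵢbⱼd ≤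
    -- G(bᵢ²+bⱼ²)`; the third product handles `-bᵢ²∂ⱼvⱼ`.
    nlinarith [mul_nonneg (sub_nonneg.2 h2) (sq_nonneg (b x i + b x j)),
      mul_nonneg (neg_le_iff_add_nonneg.1 h1) (sq_nonneg (b x i - b x j)),
      mul_nonneg (neg_le_iff_add_nonneg.1 h3) (sq_nonneg (b x i))]
  refine (Finset.sum_le_sum fun i _ => Finset.sum_le_sum fun j _ => h i j).trans_eq ?_
  rw [EuclideanSpace.norm_sq_eq]
  simp only [Real.norm_eq_abs, sq_abs, Fin.sum_univ_three]
  ring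

/-- The energy estimate at a fixed time. -/
theorem IsGaussDomain.energy_estimate {Ω W : Set E3} (hΩ : IsGaussDomain Ω)
    (hW : IsOpen W) (hΩW : closure Ω ⊆ W) {v b bb : E3 → E3} (hv : ContDiffOn ℝ 1 v W)
    (hb : ContDiffOn ℝ 1 b W) (hbb : MemLp bb 2 (surfaceMeasure Ω))
    (hin : ∀ x ∈ frontier Ω, inner ℝ (v x) (outwardNormal Ω x) < 0 → b x = bb x) :
    2 * ∫ x in Ω, ∑ i, b x i * splitTransport v b i x ≤
      9 * gradNorm Ω v * normSqL2 b (volume.restrict Ω)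
        + supNormBoundary Ω v * normSqL2 bb (surfaceMeasure Ω) := by
  have := hΩ.isFiniteMeasure
  have hvc : ContinuousOn v (closure Ω) := hv.continuousOn.mono hΩW
  have hbc : ContinuousOn b (closure Ω) := hb.continuousOn.mono hΩW
  have hflux : ∀ j, ContDiffOn ℝ 1 (fun y => v y j * ∑ i, b y i * b y i) W := fun j =>
    (hv.e3_apply j).mul (ContDiffOn.sum fun i _ => (hb.e3_apply i).mul (hb.e3_apply i))
  have hfluxint : ∀ j, IntegrableOn (pd j fun y => v y j * ∑ i, b y i * b y i) Ω := fun j =>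
    hΩ.integrableOn ((continuousOn_pd hW (hflux j) j).mono hΩW)
  have hdensint : IntegrableOn (stretchingDensity v b) Ω := by
    refine hΩ.integrableOn (continuousOn_finsetSum _ fun i _ => continuousOn_finsetSum _ fun j _ => ?_)
    have hbi := fun i => (hb.e3_apply i).continuousOn.mono hΩW
    have hpd := fun i j => (continuousOn_pd hW (hv.e3_apply i) j).mono hΩW
    exact ((continuousOn_const.mul ((hbi i).mul (hbi j))).mul (hpd i j)).sub
      (((hbi i).mul (hbi i)).mul (hpd j j))
  have hid : 2 * ∫ x in Ω, ∑ i, b x i * splitTransport v b i x =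
      (∫ x in Ω, stretchingDensity v b x) -
        ∑ j, ∫ x, (v x j * ∑ i, b x i * b x i) * outwardNormal Ω x j ∂(surfaceMeasure Ω) := by
    simp_rw [← fun j => hΩ.gauss_green_of_contDiffOn hW hΩW (hflux j) j]
    rw [← integral_finsetSum _ fun j _ => hfluxint j,
      ← integral_sub hdensint (integrable_finsetSum _ fun j _ => hfluxint j), ← integral_const_mul]
    refine setIntegral_congr_fun hΩ.isOpen.measurableSet fun x hx => ?_
    have hxW := hW.mem_nhds (hΩW (subset_closure hx))
    exact two_mul_sum_mul_splitTransport
      (fun i => ((hv.e3_apply i).contDiffAt hxW).differentiableAt one_ne_zero)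
      (fun i => ((hb.e3_apply i).contDiffAt hxW).differentiableAt one_ne_zero)
  have hvol : ∫ x in Ω, stretchingDensity v b x ≤
      9 * gradNorm Ω v * normSqL2 b (volume.restrict Ω) := by
    rw [normSqL2_eq_integral (hΩ.memLp hbc), ← integral_const_mul]
    refine integral_mono_ae hdensint
      (hΩ.integrableOn (continuousOn_const.mul (hbc.norm.pow 2))) ?_
    have hae : ∀ᵐ x ∂(volume.restrict Ω), ∀ i j, ‖pd j (fun y => v y i) x‖ ≤ gradNorm Ω v := by
      simp_rw [ae_all_iff]
      exact fun i j => hΩ.ae_norm_pd_le_gradNorm hW hΩW hv i j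
    filter_upwards [hae] with x hx
    exact stretchingDensity_le hx
  have hbdint : ∀ j, Integrable
      (fun x => (v x j * ∑ i, b x i * b x i) * outwardNormal Ω x j) (surfaceMeasure Ω) := by
    intro j
    have hc : ContinuousOn (fun y => v y j * ∑ i, b y i * b y i) (frontier Ω) :=
      (hflux j).continuousOn.mono (frontier_subset_closure.trans hΩW)
    have hcomp : IsCompact (frontier Ω) :=
      hΩ.isCompact_closure.of_isClosed_subset isClosed_frontier frontier_subset_closure
    obtain ⟨C, hC⟩ := hcomp.exists_bound_of_continuousOn hc
    refine Integrable.of_bound ((hc.aestronglyMeasurable isClosed_frontier.measurableSet).mul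
      (hΩ.aestronglyMeasurable_normal_apply j)) C ?_
    filter_upwards [ae_surfaceMeasure_mem_frontier Ω] with x hx
    rw [norm_mul]
    exact (mul_le_of_le_one_right (norm_nonneg _) (abs_outwardNormal_apply_le_one Ω x j)).trans
      (hC x hx)
  have hbd : -∑ j, ∫ x, (v x j * ∑ i, b x i * b x i) * outwardNormal Ω x j ∂(surfaceMeasure Ω) ≤
      supNormBoundary Ω v * normSqL2 bb (surfaceMeasure Ω) := by
    rw [normSqL2_eq_integral hbb, ← integral_const_mul, ← integral_finsetSum _ fun j _ => hbdint j,
      ← integral_neg]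
    refine integral_mono_ae (integrable_finsetSum _ fun j _ => hbdint j).neg
      ((hbb.integrable_norm_pow two_ne_zero).const_mul _) ?_
    filter_upwards [ae_surfaceMeasure_mem_frontier Ω, hΩ.ae_norm_le_supNormBoundary hvc]
      with x hx hxs
    have hflux_eq : ∑ j, (v x j * ∑ i, b x i * b x i) * outwardNormal Ω x j =
        inner ℝ (v x) (outwardNormal Ω x) * ‖b x‖ ^ 2 := by
      rw [EuclideanSpace.norm_sq_eq, PiLp.inner_apply]
      simp only [Real.norm_eq_abs, sq_abs, Fin.sum_univ_three, RCLike.inner_apply, conj_trivial]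
      ring
    simp only [hflux_eq]
    have hs0 : 0 ≤ supNormBoundary Ω v := (norm_nonneg _).trans hxs
    by_cases hneg : inner ℝ (v x) (outwardNormal Ω x) < 0
    -- Inflow: the data replace `b`, and `-v·ν ≤ |v|` by Cauchy–Schwarz.
    · rw [← hin x hx hneg, ← neg_mul]
      refine mul_le_mul_of_nonneg_right ?_ (sq_nonneg _)
      have h1 := (neg_le_abs _).trans (abs_real_inner_le_norm (v x) (outwardNormal Ω x))
      exact (h1.trans (mul_le_of_le_one_right (norm_nonneg _)
        (norm_outwardNormal_le_one Ω x))).trans hxs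
    -- Outflow or tangential flow: the integrand is nonpositive and is dropped.
    · have h1 : 0 ≤ inner ℝ (v x) (outwardNormal Ω x) * ‖b x‖ ^ 2 :=
        mul_nonneg (not_lt.1 hneg) (sq_nonneg _)
      have h2 : 0 ≤ supNormBoundary Ω v * ‖bb x‖ ^ 2 := mul_nonneg hs0 (sq_nonneg _)
      linarith
  rw [hid]
  linarith

/-! ### Time slices and differentiation of the energy. -/

theorem contDiffOn_one_of_continuousOn_fderiv {W : Set E3} (hW : IsOpen W) {v : E3 → E3}
    (hd : ∀ x ∈ W, DifferentiableAt ℝ v x) (hc : ContinuousOn (fderiv ℝ v) W) :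
    ContDiffOn ℝ 1 v W := by
  rw [show (1 : WithTop ℕ∞) = 0 + 1 from rfl, contDiffOn_succ_iff_fderiv_of_isOpen hW]
  exact ⟨fun x hx => (hd x hx).differentiableWithinAt, by simp, contDiffOn_zero.2 hc⟩

theorem IsSmoothVelocity.exists_contDiffOn {T : ℝ} {Ω : Set E3} {u : ℝ → E3 → E3}
    (hu : IsSmoothVelocity T Ω u) {t : ℝ} (ht : t ∈ Icc 0 T) :
    ∃ W : Set E3, IsOpen W ∧ closure Ω ⊆ W ∧ ContDiffOn ℝ 1 (u t) W := by
  obtain ⟨U, hU, hsub, -, hd, hc⟩ := hu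
  have hW : IsOpen {x : E3 | (t, x) ∈ U} := hU.preimage (by fun_prop)
  refine ⟨_, hW, fun x hx => hsub ⟨ht, hx⟩,
    contDiffOn_one_of_continuousOn_fderiv hW (fun x hx => hd (t, x) hx) ?_⟩
  exact hc.comp (f := fun x : E3 => (t, x)) (by fun_prop) fun x hx => hx

theorem IsSmoothField.exists_contDiffOn {T : ℝ} {Ω : Set E3} {B : ℝ → E3 → E3}
    (hB : IsSmoothField T Ω B) {t : ℝ} (ht : t ∈ Icc 0 T) :
    ∃ W : Set E3, IsOpen W ∧ closure Ω ⊆ W ∧ ContDiffOn ℝ 1 (B t) W := by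
  obtain ⟨U, hU, hsub, hc⟩ := hB
  refine ⟨{x : E3 | (t, x) ∈ U}, hU.preimage (by fun_prop), fun x hx => hsub ⟨ht, hx⟩, ?_⟩
  exact hc.comp (f := fun x : E3 => (t, x)) (by fun_prop) fun x hx => hx

/-- Writing `∂ₜB` as the full derivative applied to `(1, 0)` yields its joint continuity in `(t,x)`.
-/
theorem hasDerivAt_slice {U : Set (ℝ × E3)} (hU : IsOpen U) {B : ℝ → E3 → E3}
    (hB : ContDiffOn ℝ 1 (fun p : ℝ × E3 => B p.1 p.2) U) {t : ℝ} {x : E3} (h : (t, x) ∈ U) :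
    HasDerivAt (fun s => B s x) (fderiv ℝ (fun p : ℝ × E3 => B p.1 p.2) (t, x) (1, 0)) t := by
  have h1 := ((hB.contDiffAt (hU.mem_nhds h)).differentiableAt one_ne_zero).hasFDerivAt
  exact h1.comp_hasDerivAt (f := fun s : ℝ => (s, x)) t
    ((hasDerivAt_id t).prodMk (hasDerivAt_const t x))

theorem IsSmoothField.exists_timeDeriv {T : ℝ} {Ω : Set E3} {B : ℝ → E3 → E3}
    (hB : IsSmoothField T Ω B) :
    (∀ t ∈ Icc 0 T, ∀ x ∈ closure Ω, HasDerivAt (fun s => B s x) (timeDeriv B t x) t) ∧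
    ContinuousOn (fun p : ℝ × E3 => timeDeriv B p.1 p.2) (Icc 0 T ×ˢ closure Ω) := by
  obtain ⟨U, hU, hsub, hc⟩ := hB
  refine ⟨fun t ht x hx => (hasDerivAt_slice hU hc (hsub ⟨ht, hx⟩)).differentiableAt.hasDerivAt,
    ?_⟩
  have h : ContinuousOn
      (fun p : ℝ × E3 => fderiv ℝ (fun p : ℝ × E3 => B p.1 p.2) p (1, 0)) (Icc 0 T ×ˢ closure Ω) :=
    ((hc.continuousOn_fderiv_of_isOpen hU le_rfl).clm_apply continuousOn_const).mono hsub
  exact h.congr fun p hp => (hasDerivAt_slice hU hc (hsub hp)).deriv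

theorem IsSmoothField.continuousOn {T : ℝ} {Ω : Set E3} {B : ℝ → E3 → E3}
    (hB : IsSmoothField T Ω B) :
    ContinuousOn (fun p : ℝ × E3 => B p.1 p.2) (Icc 0 T ×ˢ closure Ω) := by
  obtain ⟨U, -, hsub, hc⟩ := hB
  exact hc.continuousOn.mono hsub

theorem ContinuousOn.slice {S : Set ℝ} {K : Set E3} {F : Type*} [TopologicalSpace F]
    {f : ℝ × E3 → F} (hf : ContinuousOn f (S ×ˢ K)) {t : ℝ} (ht : t ∈ S) :
    ContinuousOn (fun x => f (t, x)) K :=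
  hf.comp (f := fun x : E3 => (t, x)) (by fun_prop) fun _ hx => ⟨ht, hx⟩

theorem IsSmoothField.normSqL2_eq {T : ℝ} {Ω : Set E3} (hΩ : IsGaussDomain Ω) {B : ℝ → E3 → E3}
    (hB : IsSmoothField T Ω B) {t : ℝ} (ht : t ∈ Icc 0 T) :
    normSqL2 (B t) (volume.restrict Ω) = ∫ x in Ω, ‖B t x‖ ^ 2 :=
  normSqL2_eq_integral (hΩ.memLp (hB.continuousOn.slice ht))

theorem IsSmoothField.continuousOn_normSqL2 {T : ℝ} {Ω : Set E3} (hΩ : IsGaussDomain Ω)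
    {B : ℝ → E3 → E3} (hB : IsSmoothField T Ω B) :
    ContinuousOn (fun s => normSqL2 (B s) (volume.restrict Ω)) (Icc 0 T) := by
  have := hΩ.isFiniteMeasure_restrict
  have hsq : ContinuousOn (fun p : ℝ × E3 => ‖B p.1 p.2‖ ^ 2) (Icc 0 T ×ˢ closure Ω) :=
    hB.continuousOn.norm.pow 2
  obtain ⟨C, hC⟩ := (isCompact_Icc.prod hΩ.isCompact_closure).exists_bound_of_continuousOn hsq
  have h : ContinuousOn (fun s => ∫ x in Ω, ‖B s x‖ ^ 2) (Icc 0 T) := by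
    refine continuousOn_of_dominated (bound := fun _ => C) (fun t ht => ?_) (fun t ht => ?_)
      (integrable_const C) ?_
    · exact ((hsq.slice ht).mono subset_closure).aestronglyMeasurable hΩ.isOpen.measurableSet
    · filter_upwards [ae_restrict_mem hΩ.isOpen.measurableSet] with x hx
      exact hC (t, x) ⟨ht, subset_closure hx⟩
    · filter_upwards [ae_restrict_mem hΩ.isOpen.measurableSet] with x hx
      exact hsq.comp (f := fun t : ℝ => (t, x)) (by fun_prop) fun t ht => ⟨ht, subset_closure hx⟩
  exact h.congr fun t ht => hB.normSqL2_eq hΩ ht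

theorem IsSmoothField.hasDerivAt_normSqL2 {T : ℝ} {Ω : Set E3} (hΩ : IsGaussDomain Ω)
    {B : ℝ → E3 → E3} (hB : IsSmoothField T Ω B) {t : ℝ} (ht : t ∈ Ioo 0 T) :
    HasDerivAt (fun s => normSqL2 (B s) (volume.restrict Ω))
      (2 * ∫ x in Ω, inner ℝ (B t x) (timeDeriv B t x)) t := by
  have := hΩ.isFiniteMeasure_restrict
  obtain ⟨hder, hdc⟩ := hB.exists_timeDeriv
  have hsq : ContinuousOn (fun p : ℝ × E3 => ‖B p.1 p.2‖ ^ 2) (Icc 0 T ×ˢ closure Ω) :=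
    hB.continuousOn.norm.pow 2
  have hinner : ContinuousOn (fun p : ℝ × E3 => 2 * inner ℝ (B p.1 p.2) (timeDeriv B p.1 p.2))
      (Icc 0 T ×ˢ closure Ω) := continuousOn_const.mul (hB.continuousOn.inner hdc)
  -- Compactness of `[0,T] × closure Ω` gives a constant dominating the time derivative of `‖B‖²`,
  -- uniformly for times near `t`.
  obtain ⟨C, hC⟩ := (isCompact_Icc.prod hΩ.isCompact_closure).exists_bound_of_continuousOn hinner
  have hnhds : Icc 0 T ∈ 𝓝 t := Icc_mem_nhds ht.1 ht.2
  have htI := Ioo_subset_Icc_self ht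
  have h := (hasDerivAt_integral_of_dominated_loc_of_deriv_le (μ := volume.restrict Ω)
    (F := fun s x => ‖B s x‖ ^ 2) (F' := fun s x => 2 * inner ℝ (B s x) (timeDeriv B s x))
    (bound := fun _ => C) hnhds ?_ (hΩ.integrableOn (hsq.slice htI)) ?_ ?_
    (integrable_const C) ?_).2
  · rw [integral_const_mul] at h
    refine h.congr_of_eventuallyEq ?_
    filter_upwards [hnhds] with s hs
    exact hB.normSqL2_eq hΩ hs
  · filter_upwards [hnhds] with s hs
    exact ((hsq.slice hs).mono subset_closure).aestronglyMeasurable hΩ.isOpen.measurableSet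
  · exact ((hinner.slice htI).mono subset_closure).aestronglyMeasurable hΩ.isOpen.measurableSet
  · filter_upwards [ae_restrict_mem hΩ.isOpen.measurableSet] with x hx s hs
    exact hC (s, x) ⟨hs, subset_closure hx⟩
  · filter_upwards [ae_restrict_mem hΩ.isOpen.measurableSet] with x hx s hs
    exact (hder s hs x (subset_closure hx)).norm_sq

/-! ### From space-time bounds to time slices, and Grönwall. -/

/-- If continuous `|f|` exceeds `C` at one point of `O`, it does so on a nonempty open set, which
has positive measure. A single time slice is null in space-time, so `gradNorm_le` needs this
everywhere version. -/
theorem IsOpen.forall_norm_le_of_ae {α : Type*} [TopologicalSpace α] [MeasurableSpace α]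
    [OpensMeasurableSpace α] {μ : Measure α} [μ.IsOpenPosMeasure] {O : Set α} (hO : IsOpen O)
    {f : α → ℝ} (hf : ContinuousOn f O) {C : ℝ} (h : ∀ᵐ x ∂(μ.restrict O), ‖f x‖ ≤ C) :
    ∀ x ∈ O, ‖f x‖ ≤ C := by
  have hopen : IsOpen (O ∩ (fun x => ‖f x‖) ⁻¹' Ioi C) := hf.norm.isOpen_inter_preimage hO isOpen_Ioi
  have hnull : μ (O ∩ (fun x => ‖f x‖) ⁻¹' Ioi C) = 0 := by
    rw [ae_restrict_iff' hO.measurableSet, ae_iff] at h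
    refine measure_mono_null (fun x hx => ?_) h
    simpa using hx
  rw [hopen.measure_eq_zero_iff μ] at hnull
  intro x hx
  by_contra hlt
  exact (hnull ▸ (⟨hx, not_le.1 hlt⟩ : x ∈ O ∩ (fun x => ‖f x‖) ⁻¹' Ioi C) : x ∈ (∅ : Set α))

theorem IsSmoothVelocity.continuousOn_pd {T : ℝ} {Ω : Set E3} {u : ℝ → E3 → E3}
    (hu : IsSmoothVelocity T Ω u) (i j : Fin 3) :
    ContinuousOn (fun p : ℝ × E3 => pd j (fun y => u p.1 y i) p.2) (Icc 0 T ×ˢ closure Ω) := by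
  obtain ⟨U, -, hsub, -, hd, hc⟩ := hu
  have h : ContinuousOn (fun p : ℝ × E3 => fderiv ℝ (u p.1) p.2 (EuclideanSpace.single j 1) i)
      (Icc 0 T ×ˢ closure Ω) :=
    (EuclideanSpace.proj (𝕜 := ℝ) i).continuous.comp_continuousOn
      ((hc.clm_apply continuousOn_const).mono hsub)
  refine h.congr fun p hp => ?_
  have := ((EuclideanSpace.proj (𝕜 := ℝ) i).hasFDerivAt.comp p.2 (hd p (hsub hp)).hasFDerivAt).fderiv
  exact congrArg (fun L : E3 →L[ℝ] ℝ => L (EuclideanSpace.single j 1)) this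

theorem IsSmoothVelocity.gradNorm_le {T : ℝ} {Ω : Set E3} (hΩ : IsGaussDomain Ω)
    {u : ℝ → E3 → E3} (hu : IsSmoothVelocity T Ω u) {t : ℝ} (ht : t ∈ Ioo 0 T) :
    gradNorm Ω (u t) ≤ gradNormSpaceTime T Ω u := by
  have hO : IsOpen (Ioo 0 T ×ˢ Ω) := isOpen_Ioo.prod hΩ.isOpen
  have hsub : Ioo 0 T ×ˢ Ω ⊆ Icc 0 T ×ˢ closure Ω := prod_mono Ioo_subset_Icc_self subset_closure
  have hae := ae_norm_le_iSup_eLpNorm (μ := volume.restrict (Ioo 0 T ×ˢ Ω))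
    (f := fun i j (p : ℝ × E3) => pd j (fun y => u p.1 y i) p.2) (fun i j => by
      obtain ⟨C, hC⟩ := (isCompact_Icc.prod hΩ.isCompact_closure).exists_bound_of_continuousOn
        (hu.continuousOn_pd i j)
      refine ⟨C, ?_⟩
      filter_upwards [ae_restrict_mem hO.measurableSet] with p hp
      exact hC p (hsub hp))
  refine ENNReal.toReal_le_of_le_ofReal ENNReal.toReal_nonneg (iSup₂_le fun i j => ?_)
  rw [eLpNorm_exponent_top]
  refine eLpNormEssSup_le_of_ae_bound ?_
  filter_upwards [ae_restrict_mem hΩ.isOpen.measurableSet] with x hx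
  exact hO.forall_norm_le_of_ae ((hu.continuousOn_pd i j).mono hsub) (hae i j) (t, x) ⟨ht, hx⟩

/-- Grönwall's inequality with an integrable source. -/
theorem gronwall_of_integrable_source {T G t : ℝ} {e e' h : ℝ → ℝ}
    (hG : 0 ≤ G) (hcont : ContinuousOn e (Icc 0 T)) (hderiv : ∀ s ∈ Ioo 0 T, HasDerivAt e (e' s) s)
    (hle : ∀ s ∈ Ioo 0 T, e' s ≤ G * e s + h s) (hh : ∀ s, 0 ≤ h s)
    (hint : IntegrableOn h (Ioo 0 T)) (ht : t ∈ Icc 0 T) :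
    e t ≤ Real.exp (G * t) * (e 0 + ∫ s in (0 : ℝ)..t, h s) := by
  have hsub : Icc 0 t ⊆ Icc 0 T := Icc_subset_Icc_right ht.2
  -- With integrating factor `exp(-Gs)`, the derivative of `exp(-Gs) e` is at most `exp(-Gs) h ≤ h`,
  -- as `G`, `s` and `h` are nonnegative. This one-sided fundamental theorem asks only that `h` be
  -- integrable, not `e'`.
  have hmono := intervalIntegral.sub_le_integral_of_hasDeriv_right_of_le
    (g := fun s => Real.exp (-(G * s)) * e s) (φ := h)
    (g' := fun s => Real.exp (-(G * s)) * -(G * 1) * e s + Real.exp (-(G * s)) * e' s) ht.1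
    ((Continuous.continuousOn (by fun_prop)).mul (hcont.mono hsub))
    (fun s hs => (((((hasDerivAt_id s).const_mul G).neg).exp).mul
      (hderiv s ⟨hs.1, hs.2.trans_le ht.2⟩)).hasDerivWithinAt)
    (by
      rw [integrableOn_Icc_iff_integrableOn_Ioo]
      exact hint.mono_set (Ioo_subset_Ioo_right ht.2))
    (fun s hs => by
      have h1 := hle s ⟨hs.1, hs.2.trans_le ht.2⟩
      have h2 : Real.exp (-(G * s)) ≤ 1 :=
        Real.exp_le_one_iff.2 (neg_nonpos.2 (mul_nonneg hG hs.1.le))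
      calc _ = Real.exp (-(G * s)) * (e' s - G * e s) := by ring
        _ ≤ Real.exp (-(G * s)) * h s :=
          mul_le_mul_of_nonneg_left (by linarith) (Real.exp_pos _).le
        _ ≤ h s := mul_le_of_le_one_left (hh s) h2)
  simp only [mul_zero, neg_zero, Real.exp_zero, one_mul, sub_le_iff_le_add'] at hmono
  calc e t = Real.exp (G * t) * (Real.exp (-(G * t)) * e t) := by
        rw [← mul_assoc, ← Real.exp_add, add_neg_cancel, Real.exp_zero, one_mul]
    _ ≤ _ := mul_le_mul_of_nonneg_left hmono (Real.exp_pos _).le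

/-! ### Assembly for solutions of the induction equation. -/

theorem SolvesInduction.energy_estimate {T : ℝ} {Ω : Set E3} (hΩ : IsGaussDomain Ω)
    {u : ℝ → E3 → E3} (hu : IsSmoothVelocity T Ω u) {B0 : E3 → E3} {Bb B : ℝ → E3 → E3}
    (hBb : ∀ t ∈ Ioo 0 T, MemLp (Bb t) 2 (surfaceMeasure Ω))
    (hB : SolvesInduction T Ω u B0 Bb B) {t : ℝ} (ht : t ∈ Ioo 0 T) :
    2 * ∫ x in Ω, inner ℝ (B t x) (timeDeriv B t x) ≤
      9 * gradNorm Ω (u t) * normSqL2 (B t) (volume.restrict Ω)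
        + supNormBoundary Ω (u t) * normSqL2 (Bb t) (surfaceMeasure Ω) := by
  obtain ⟨W₁, hW₁, hΩ₁, hv⟩ := hu.exists_contDiffOn (Ioo_subset_Icc_self ht)
  obtain ⟨W₂, hW₂, hΩ₂, hb⟩ := hB.smooth.exists_contDiffOn (Ioo_subset_Icc_self ht)
  have := hΩ.energy_estimate (hW₁.inter hW₂) (subset_inter hΩ₁ hΩ₂) (hv.mono inter_subset_left)
    (hb.mono inter_subset_right) (hBb t ht) (hB.inflow t ht)
  rwa [setIntegral_congr_fun hΩ.isOpen.measurableSet fun x hx => ?_]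
  simp only [PiLp.inner_apply, RCLike.inner_apply, conj_trivial, hB.pde t ht x hx]
  exact Finset.sum_congr rfl fun i _ => mul_comm _ _

theorem mainTheorem6
    (T : ℝ) (hT : 0 < T) (Ω : Set E3) (hΩ : IsGaussDomain Ω)
    (u : ℝ → E3 → E3) (hu : IsSmoothVelocity T Ω u)
    (B0 : E3 → E3) (Bb B : ℝ → E3 → E3)
    (hBb : ∀ t ∈ Ioo 0 T, MemLp (Bb t) 2 (surfaceMeasure Ω))
    (hB : SolvesInduction T Ω u B0 Bb B) :
    (∀ t ∈ Ioo 0 T,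
      HasDerivAt (fun s => normSqL2 (B s) (volume.restrict Ω))
        (2 * ∫ x in Ω, inner ℝ (B t x) (timeDeriv B t x)) t ∧
      2 * ∫ x in Ω, inner ℝ (B t x) (timeDeriv B t x) ≤
        9 * gradNorm Ω (u t) * normSqL2 (B t) (volume.restrict Ω)
          + supNormBoundary Ω (u t) * normSqL2 (Bb t) (surfaceMeasure Ω)) ∧
    (IntegrableOn
        (fun s => supNormBoundary Ω (u s) * normSqL2 (Bb s) (surfaceMeasure Ω)) (Ioo 0 T) →
      ∀ t ∈ Icc 0 T,
        normSqL2 (B t) (volume.restrict Ω) ≤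
          Real.exp (9 * gradNormSpaceTime T Ω u * t) *
            (normSqL2 B0 (volume.restrict Ω)
              + ∫ s in (0 : ℝ)..t,
                  supNormBoundary Ω (u s) * normSqL2 (Bb s) (surfaceMeasure Ω))) := by
  refine ⟨fun t ht => ⟨hB.smooth.hasDerivAt_normSqL2 hΩ ht, hB.energy_estimate hΩ hu hBb ht⟩,
    fun hint t ht => ?_⟩
  have hB0 : normSqL2 B0 (volume.restrict Ω) = normSqL2 (B 0) (volume.restrict Ω) := by
    rw [normSqL2, normSqL2, eLpNorm_congr_ae]
    filter_upwards [ae_restrict_mem hΩ.isOpen.measurableSet] with x hx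
    exact (hB.initial x hx).symm
  rw [hB0]
  refine gronwall_of_integrable_source
    (h := fun s => supNormBoundary Ω (u s) * normSqL2 (Bb s) (surfaceMeasure Ω))
    (mul_nonneg (by norm_num) ENNReal.toReal_nonneg) (hB.smooth.continuousOn_normSqL2 hΩ)
    (fun s hs => hB.smooth.hasDerivAt_normSqL2 hΩ hs) (fun s hs => ?_)
    (fun s => mul_nonneg ENNReal.toReal_nonneg (normSqL2_nonneg _ _)) hint ht
  refine (hB.energy_estimate hΩ hu hBb hs).trans (add_le_add_left ?_ _)
  exact mul_le_mul_of_nonneg_right (mul_le_mul_of_nonneg_left (hu.gradNorm_le hΩ hs) (by norm_num))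
    (normSqL2_nonneg _ _)
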